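/- Conventions. All vector spaces and (co)chains are real. Let $\Delta_r=\{(t_1,\dots,t_r): 1\ge t_1\ge\dots\ge t_r\ge 0\}$. For a manifold $M$, $C_\bullet(M)$ is the space of smooth singular chains with real coefficients and $C^\bullet(M)$ its dual; $\Omega^q(M)$ is the space of differential $q$-forms. An integral of a form over a domain of a different dimension is zero. *Gugenheim's maps.* For $\alpha\in\Omega^{q}(M)$ let $\mathsf{DR}_1(\alpha)(\sigma)=\int_{\Delta_r}\sigma^*\alpha$ for every smooth $\sigma:\Delta_r\to M$. For $n>1$ and $\alpha_i\in\Omega^{q_i}(M)$ let $$\mathsf{C}(\alpha_1\otimes\dots\otimes\alpha_n)=(-1)^{\sum_{j}(q_j+1)(n-j)}\,\pi_*\,\mathrm{ev}^*(p_1^*\alpha_1\wedge\dots\wedge p_n^*\alpha_n),$$ a differential form on the path space $PM$, where $\mathrm{ev}:\Delta_n\times PM\to M^n$, $\mathrm{ev}((t_1,\dots,t_n),\gamma)=(\gamma(t_1),\dots,\gamma(t_n))$, $p_i:M^n\to M$ are the projections, and $\pi_*$ is integration along the fibres of $\pi:\Delta_n\times PM\to PM$. Let $\lambda_r:I^{r-1}\to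 PI^r$ send $s$ to the piecewise linear path which goes backwards through $0\leftarrow s_1e_1\leftarrow s_1e_1+s_2e_2\leftarrow\dots\leftarrow s_1e_1+\dots+s_{r-1}e_{r-1}+e_r$, let $\pi_r:I^r\to\Delta_r$, $\pi_r(s)_i=\max\{s_i,\dots,s_r\}$, and let $\theta_r=P\pi_r\circ\lambda_r:I^{r-1}\to P\Delta_r$ (for $r=0$, the constant path at the point $\Delta_0$). For a form $\varphi$ on $PM$ and a smooth $\sigma:\Delta_r\to M$ let $\mathsf{S}(\varphi)(\sigma)=\int_{I^{r-1}}\theta_r^*(P\sigma)^*\varphi$ and put $$\mathsf{DR}_n(u\alpha_1\otimes\dots\otimes u\alpha_n)=(-1)^{\sum_j (q_j+1)+n}\,(\mathsf{S}\circ\mathsf{C})(\alpha_1\otimes\dots\otimes\alpha_n)\in C^\bullet(M).$$ *The map $\mathsf{DR}^\Theta$.* Let $G$ be a finite-dimensional real Lie group and $BG_\bullet$ the simplicial manifold with $BG_p=G^p$. Let $$EZ_P:C_\bullet(G)^{\otimes P}\to C_\bullet(G^P),\qquad EZ_P(\sigma_1\otimes\dots\otimes\sigma_P)=\sum_\chi(-1)^\chi(\sigma_1\times\dots\times\sigma_P)\circ\chi_*$$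 be the Eilenberg–Zilber map, the sum being over all $(r_1,\dots,r_P)$-shuffles $\chi$, where $\sigma_i$ is an $r_i$-simplex and $\chi_*(t)=((t_{\chi(1)},\dots,t_{\chi(r_1)}),\dots,(\dots,t_{\chi(r_1+\dots+r_P)}))$. For $\alpha_i\in\Omega^{q_i}(BG_{p_i})$ put $P=\sum_j p_j$, $r_i=\sum_{j<i}p_j$, let $l_i:G^P\to G^{p_i}$ be $(g_1,\dots,g_P)\mapsto(g_{r_i+1},\dots,g_{r_i+p_i})$, and $$\mathrm{Tot}(\mathsf{DR}^\Delta)_n(u\alpha_1\otimes\dots\otimes u\alpha_n)=(-1)^{\sum_{i<j}p_j(q_i+1)}\,\mathsf{DR}_n(u\,l_1^*\alpha_1\otimes\dots\otimes u\,l_n^*\alpha_n)\circ EZ_P\in\mathrm{Hom}(C_\bullet(G)^{\otimes P},\mathbb R).$$ Let $HC^\bullet(C_\bullet(G))=\bigoplus_P\mathrm{Hom}((u\,C_\bullet(G))^{\otimes P},\mathbb R)$ be the space of Hochschild cochains, $u$ denoting the degree shift, and let $\Theta$ be the isomorphism from $\bigoplus_P \mathrm{Hom}(C_\bullet(G)^{\otimes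 P},\mathbb R)$ to it with $$\Theta(\varphi)(ua_1\otimes\dots\otimes ua_P)=(-1)^{P|\varphi|+P(P-1)/2+\sum_{i=1}^{P-1}|a_i|(P-i)}\,\varphi(a_1\otimes\dots\otimes a_P).$$ Define $\mathsf{DR}^\Theta_n=\Theta\circ\mathrm{Tot}(\mathsf{DR}^\Delta)_n$. **Proposition.** Let $n>1$ and let $\omega_1\in\Omega^{q_1}(G),\dots,\omega_n\in\Omega^{q_n}(G)$, regarded as forms on $BG_1=G$. Then $$\mathsf{DR}^\Theta_n(u\omega_1\otimes\dots\otimes u\omega_n)=0\quad\text{in } HC^\bullet(C_\bullet(G)).$$ -/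

import Mathlib

open Set MeasureTheory
open scoped Manifold ContDiff Topology TensorProduct DirectSum

noncomputable section

namespace HochschildDeRham

section Products

variable {E : Type*} [NormedAddCommGroup E] [NormedSpace ℝ E]
  {H : Type*} [TopologicalSpace H] (I : ModelWithCorners ℝ E H)
  {M : Type*} [TopologicalSpace M] [ChartedSpace H M]

/-- The model with corners of the `p`-fold product of a manifold with model `I`. -/
abbrev powModel (p : ℕ) : ModelWithCorners ℝ (Fin p → E) (ModelPi fun _ : Fin p => H) :=
  ModelWithCorners.pi fun _ => I

instance isManifold_pow (p : ℕ) (k : ℕ∞ω) [IsManifold I k M] :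
    IsManifold (powModel I p) k (Fin p → M) := by
  apply isManifold_of_contDiffOn
  rintro _ _ ⟨e, he, rfl⟩ ⟨e', he', rfl⟩
  rw [contDiffOn_pi]
  intro i
  have h : ContDiffOn ℝ k (I ∘ ((e i).symm ≫ₕ e' i) ∘ I.symm)
      (I.symm ⁻¹' ((e i).symm ≫ₕ e' i).source ∩ range I) :=
    ((contDiffGroupoid k I).compatible (he i (mem_univ i)) (he' i (mem_univ i))).1
  refine h.comp (contDiff_apply ℝ E i).contDiffOn ?_
  rintro x ⟨hx, y, rfl⟩
  refine ⟨?_, y i, rfl⟩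
  simp only [OpenPartialHomeomorph.trans_source, mem_preimage, mem_inter_iff] at hx ⊢
  exact ⟨hx.1 i (mem_univ i), hx.2 i (mem_univ i)⟩

theorem contMDiff_proj {p : ℕ} (i : Fin p) :
    ContMDiff (powModel I p) I ∞ (fun g : Fin p → M => g i) := by
  intro g
  rw [contMDiffAt_iff]
  refine ⟨(continuous_apply i).continuousAt, ?_⟩
  have h : ContDiffWithinAt ℝ ∞ (fun v : Fin p → E => v i) (range (powModel I p))
      (extChartAt (powModel I p) g g) := (contDiff_apply ℝ E i).contDiffWithinAt
  refine h.congr_of_eventuallyEq ?_ ?_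
  · filter_upwards [extChartAt_target_mem_nhdsWithin (I := powModel I p) g] with v hv
    have hv' : v i ∈ (extChartAt I (g i)).target := by
      rw [extChartAt_target] at hv ⊢
      obtain ⟨hv1, y, rfl⟩ := hv
      exact ⟨hv1 i (mem_univ i), y i, rfl⟩
    exact (extChartAt I (g i)).right_inv hv'
  · exact (extChartAt I (g i)).right_inv (mem_extChartAt_target (I := I) (g i))

theorem contMDiffOn_pow {E' : Type*} [NormedAddCommGroup E'] [NormedSpace ℝ E']
    {H' : Type*} [TopologicalSpace H'] {I' : ModelWithCorners ℝ E' H'}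
    {N : Type*} [TopologicalSpace N] [ChartedSpace H' N] {p : ℕ} {f : N → Fin p → M} {s : Set N}
    (h : ∀ i, ContMDiffOn I' I ∞ (fun x => f x i) s) : ContMDiffOn I' (powModel I p) ∞ f s := by
  intro x hx
  rw [contMDiffWithinAt_iff]
  refine ⟨continuousWithinAt_pi.2 fun i => (h i x hx).continuousWithinAt, ?_⟩
  rw [contDiffWithinAt_pi]
  intro i
  exact ((contMDiffWithinAt_iff.1 (h i x hx)).2)

end Products

section Alt
variable {V W : Type*} [NormedAddCommGroup V] [NormedSpace ℝ V] [NormedAddCommGroup W] [NormedSpace ℝ W]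

theorem contDiff_compContinuousLinearMap (q : ℕ) :
    ContDiff ℝ ∞ (fun p : (W [⋀^Fin q]→L[ℝ] ℝ) × (V →L[ℝ] W) =>
      p.1.compContinuousLinearMap p.2) := by
  let J : (W [⋀^Fin q]→L[ℝ] ℝ) →L[ℝ] ContinuousMultilinearMap ℝ (fun _ : Fin q => W) ℝ :=
    ContinuousAlternatingMap.toContinuousMultilinearMapCLM ℝ
  let P : ContinuousMultilinearMap ℝ (fun _ : Fin q => V) ℝ →L[ℝ] (V [⋀^Fin q]→L[ℝ] ℝ) :=
    LinearMap.mkContinuous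
      { toFun := fun f => ContinuousMultilinearMap.alternatization f
        map_add' := map_add _
        map_smul' := fun c f => by
          ext v
          simp [ContinuousMultilinearMap.alternatization_apply_apply, Finset.mul_sum,
            Units.smul_def, mul_left_comm] } (q.factorial : ℝ)
      (fun f => by
        refine ContinuousAlternatingMap.opNorm_le_bound _ (by positivity) fun v => ?_
        simp only [LinearMap.coe_mk, AddHom.coe_mk,
          ContinuousMultilinearMap.alternatization_apply_apply]
        refine (norm_sum_le _ _).trans ?_
        have : ∀ σ : Equiv.Perm (Fin q), ‖Equiv.Perm.sign σ • f (v ∘ σ)‖ ≤ ‖f‖ * ∏ i, ‖v i‖ := by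
          intro σ
          have h1 : ‖Equiv.Perm.sign σ • f (v ∘ σ)‖ = ‖f (v ∘ σ)‖ := by
            rcases Int.units_eq_one_or (Equiv.Perm.sign σ) with h | h <;> simp [h]
          rw [h1]
          refine (f.le_opNorm _).trans_eq ?_
          rw [← Equiv.prod_comp σ (fun i => ‖v i‖)]
          rfl
        refine (Finset.sum_le_sum fun σ _ => this σ).trans_eq ?_
        simp [Fintype.card_perm, mul_assoc])
  have key : (fun p : (W [⋀^Fin q]→L[ℝ] ℝ) × (V →L[ℝ] W) => p.1.compContinuousLinearMap p.2) =
      fun p => (q.factorial : ℝ)⁻¹ • P ((J p.1).compContinuousLinearMap fun _ => p.2) := by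
    funext p
    ext v
    have hq : (q.factorial : ℝ) ≠ 0 := by positivity
    have : ∀ σ : Equiv.Perm (Fin q), Equiv.Perm.sign σ • p.1 (fun i => p.2 (v (σ i)))
        = p.1 (fun i => p.2 (v i)) := by
      intro σ
      have := p.1.toAlternatingMap.map_perm (fun i => p.2 (v i)) σ
      simp only [Function.comp_def] at this
      erw [this, smul_smul]
      simp 
    simp [P, J, ContinuousMultilinearMap.alternatization_apply_apply, Function.comp_def, this, Fintype.card_perm]
    field_simp
  rw [key]
  have h1 : ContDiff ℝ ∞ (fun p : (Fin q → (V →L[ℝ] W)) ×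
      ContinuousMultilinearMap ℝ (fun _ : Fin q => W) ℝ => p.2.compContinuousLinearMap p.1) :=
    AnalyticOnNhd.contDiff
      (ContinuousMultilinearMap.analyticOnNhd_uncurry_compContinuousLinearMap (t := univ))
  have h2 : ContDiff ℝ ∞ (fun p : (W [⋀^Fin q]→L[ℝ] ℝ) × (V →L[ℝ] W) =>
      ((fun _ : Fin q => p.2), J p.1)) :=
    (contDiff_pi.2 fun _ => contDiff_snd).prodMk (J.contDiff.comp contDiff_fst)
  have h3 := P.contDiff (n := ∞) |>.comp (h1.comp h2)
  exact h3.const_smul ((q.factorial : ℝ)⁻¹)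
end Alt

section Forms

variable {E : Type*} [NormedAddCommGroup E] [NormedSpace ℝ E]
  {H : Type*} [TopologicalSpace H] (I : ModelWithCorners ℝ E H)
  (M : Type*) [TopologicalSpace M] [ChartedSpace H M] [IsManifold I ∞ M]

/-- `Ω^q(M)`: differential `q`-forms, that is, smooth sections of the bundle of alternating
`q`-linear forms on the tangent spaces. -/
abbrev DiffForm (q : ℕ) : Type _ :=
  ContMDiffSection I (E [⋀^Fin q]→L[ℝ] ℝ) ∞
    (fun x : M => TangentSpace I x [⋀^Fin q]→L[ℝ] Bundle.Trivial M ℝ x)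

variable {I M} {E' : Type*} [NormedAddCommGroup E'] [NormedSpace ℝ E']
  {H' : Type*} [TopologicalSpace H'] {I' : ModelWithCorners ℝ E' H'}
  {N : Type*} [TopologicalSpace N] [ChartedSpace H' N] [IsManifold I' ∞ N]

/-- The pullback `f^* α` of a differential form along a smooth map. -/
def DiffForm.pullback {q : ℕ} (α : DiffForm I M q) (f : N → M) (hf : ContMDiff I' I ∞ f) :
    DiffForm I' N q where
  toFun x := (α (f x)).compContinuousLinearMap (mfderiv I' I f x)
  contMDiff_toFun := by
    intro x₀
    rw [Bundle.contMDiffAt_section]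
    have hα := (Bundle.contMDiffAt_section (f x₀)).1 (α.contMDiff_toFun (f x₀))
    have h1 : ContMDiffAt I' 𝓘(ℝ, E [⋀^Fin q]→L[ℝ] ℝ) ∞ _ x₀ := hα.comp x₀ (hf x₀)
    have h2 := ContMDiffAt.mfderiv_const (hf x₀) (m := ∞) (by rfl)
    have h3 := (contDiff_compContinuousLinearMap (V := E') (W := E) q).contMDiff.contMDiffAt.comp x₀
      (h1.prodMk_space h2)
    refine h3.congr_of_eventuallyEq ?_
    have hb : ∀ᶠ x in 𝓝 x₀, f x ∈ (trivializationAt E (TangentSpace I) (f x₀)).baseSet :=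
      (hf x₀).continuousAt.eventually
        ((trivializationAt E (TangentSpace I) (f x₀)).open_baseSet.mem_nhds
          (mem_baseSet_trivializationAt _ _ _))
    filter_upwards [hb] with x hx
    ext v
    simp [FiberBundle.trivializationAt_continuousAlternatingMap_apply,
      ContinuousAlternatingMap.inCoordinates, inTangentCoordinates,
      ContinuousLinearMap.inCoordinates, Function.comp_def]
    exact congrArg (α (f x)) (funext fun k =>
      (Bundle.Trivialization.symmL_continuousLinearMapAt _ hx _).symm)

end Forms

/-- The exterior product `α₁ ∧ ⋯ ∧ αₙ` of alternating forms of degrees `q₁, …, qₙ`, evaluated on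
`q₁ + ⋯ + qₙ` vectors:
`1 / (q₁! ⋯ qₙ!) * ∑_τ sgn(τ) α₁(v_{τ(1)}, …, v_{τ(q₁)}) α₂(v_{τ(q₁ + 1)}, …) ⋯`. -/
def wedge {V : Type*} [NormedAddCommGroup V] [NormedSpace ℝ V] {n : ℕ} {q : Fin n → ℕ}
    (α : ∀ i, V [⋀^Fin (q i)]→L[ℝ] ℝ) (v : Fin (∑ i, q i) → V) : ℝ :=
  (∏ i, ((q i).factorial : ℝ))⁻¹ * ∑ τ : Equiv.Perm (Fin (∑ i, q i)),
    ((Equiv.Perm.sign τ : ℤ) : ℝ) * ∏ i, α i (fun j => v (τ (finSigmaFinEquiv ⟨i, j⟩)))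

/-- The simplex `Δ_r = {1 ≥ t₁ ≥ ⋯ ≥ t_r ≥ 0}` in `ℝ^r`. -/
def simplex (r : ℕ) : Set (Fin r → ℝ) := {t | Antitone t ∧ ∀ i, t i ∈ Icc (0 : ℝ) 1}

theorem zero_mem_simplex (r : ℕ) : (0 : Fin r → ℝ) ∈ simplex r :=
  ⟨fun _ _ _ => le_rfl, fun _ => ⟨le_rfl, zero_le_one⟩⟩

/-- The cube `I^m = [0, 1]^m`. -/
def cube (m : ℕ) : Set (Fin m → ℝ) := {s | ∀ i, s i ∈ Icc (0 : ℝ) 1}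

section Simplices

variable {E : Type*} [NormedAddCommGroup E] [NormedSpace ℝ E]
  {H : Type*} [TopologicalSpace H] (I : ModelWithCorners ℝ E H)
  (M : Type*) [TopologicalSpace M] [ChartedSpace H M]

/-- Smooth singular `r`-simplices `σ : Δ_r → M`: the maps that extend to a smooth map on an open
neighbourhood of `Δ_r` in `ℝ^r`. -/
structure SmoothSimplex (r : ℕ) where
  toFun : simplex r → M
  smooth : ∃ (U : Set (Fin r → ℝ)) (f : (Fin r → ℝ) → M), IsOpen U ∧ simplex r ⊆ U ∧
    ContMDiffOn 𝓘(ℝ, Fin r → ℝ) I ∞ f U ∧ ∀ t : simplex r, f t = toFun t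

/-- `C_•(M)`: smooth singular chains with real coefficients. -/
abbrev Chains : Type _ := (Σ r : ℕ, SmoothSimplex I M r) →₀ ℝ

/-- `C^•(M)`: smooth singular cochains with real coefficients. -/
abbrev Cochains : Type _ := Chains I M →ₗ[ℝ] ℝ

variable {I M}

open Classical in
/-- A singular simplex as a function on all of `ℝ^r`, with an arbitrary constant value outside
`Δ_r`. It is only ever evaluated and differentiated within `Δ_r`. -/
def SmoothSimplex.ext {r : ℕ} (σ : SmoothSimplex I M r) (t : Fin r → ℝ) : M :=
  if h : t ∈ simplex r then σ.toFun ⟨t, h⟩ else σ.toFun ⟨0, zero_mem_simplex r⟩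

/-- `∫_{Δ_r} σ^* α`, which is zero unless the degree of `α` is `r`. -/
def integrate [IsManifold I ∞ M] {k r : ℕ} (α : DiffForm I M k) (σ : SmoothSimplex I M r) : ℝ :=
  if h : k = r then
    ∫ t in simplex r, α (σ.ext t) (fun i : Fin k =>
      mfderivWithin 𝓘(ℝ, Fin r → ℝ) I σ.ext (simplex r) t (Pi.single (Fin.cast h i) (1 : ℝ)))
  else 0

end Simplices

section Gugenheim

/-- A differential form on the path space of `M` is determined by its pullbacks along families of
paths. The value `φ C γ d x v` is the degree `d` component of the pullback of `φ` along the family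
`γ : C → P M` (where `C ⊆ ℝ^m`, and `γ x t` is the path with parameter `x ∈ C` at time `t ∈ [0, 1]`),
taken at the point `x` and evaluated on the `d` tangent vectors `v`. -/
abbrev PathForm (M : Type*) : Type _ :=
  ∀ {m : ℕ} (_ : Set (Fin m → ℝ)) (_ : (Fin m → ℝ) → ℝ → M) (d : ℕ),
    (Fin m → ℝ) → (Fin d → Fin m → ℝ) → ℝ

/-- Integration along the fibres `π_*` of `π : Δ_n × X → X`, for a form `β` of degree `N` and
`X ⊆ ℝ^m`: the component of degree `d = N - n` of the result, at `x` on the vectors `v`. -/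
def fiberIntegral {n m N : ℕ} (d : ℕ)
    (β : (Fin n → ℝ) × (Fin m → ℝ) → (Fin N → (Fin n → ℝ) × (Fin m → ℝ)) → ℝ)
    (x : Fin m → ℝ) (v : Fin d → Fin m → ℝ) : ℝ :=
  if h : N = n + d then
    ∫ t in simplex n, β (t, x) (fun k =>
      Fin.append (fun i : Fin n => ((Pi.single i 1 : Fin n → ℝ), (0 : Fin m → ℝ)))
        (fun j : Fin d => ((0 : Fin n → ℝ), v j)) (Fin.cast h k))
  else 0

/-- The evaluation map `((t₁, …, tₙ), x) ↦ (γ_x(t₁), …, γ_x(tₙ))` along a family `γ` of paths. -/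
def evMap {M : Type*} {m : ℕ} (n : ℕ) (γ : (Fin m → ℝ) → ℝ → M)
    (z : (Fin n → ℝ) × (Fin m → ℝ)) : Fin n → M :=
  fun i => γ z.2 (z.1 i)

variable {E : Type*} [NormedAddCommGroup E] [NormedSpace ℝ E]
  {H : Type*} [TopologicalSpace H] {I : ModelWithCorners ℝ E H}
  {M : Type*} [TopologicalSpace M] [ChartedSpace H M] [IsManifold I ∞ M]

/-- The form `ev^*(p₁^* α₁ ∧ ⋯ ∧ pₙ^* αₙ)` on `Δ_n × C`, for a family `γ` of paths parametrised
by `C`. Here `p_i : M^n → M` is the `i`-th projection. -/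
def evPullback {n m : ℕ} {q : Fin n → ℕ} (α : ∀ i, DiffForm I M (q i)) (C : Set (Fin m → ℝ))
    (γ : (Fin m → ℝ) → ℝ → M) (z : (Fin n → ℝ) × (Fin m → ℝ))
    (v : Fin (∑ i, q i) → (Fin n → ℝ) × (Fin m → ℝ)) : ℝ :=
  wedge (V := Fin n → E)
    (fun i => ((α i).pullback (fun g : Fin n → M => g i) (contMDiff_proj I i)) (evMap n γ z))
    (fun k => mfderivWithin 𝓘(ℝ, (Fin n → ℝ) × (Fin m → ℝ)) (powModel I n) (evMap n γ)
      (simplex n ×ˢ C) z (v k))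

/-- Chen's iterated integral
`C(α₁ ⊗ ⋯ ⊗ αₙ) = (-1)^{∑ |α_j| (n - j)} π_* ev^*(p₁^* α₁ ∧ ⋯ ∧ pₙ^* αₙ)`.
The degree `|α_j|` is taken in the shifted complex, so it has the parity of `q_j + 1`. -/
def chen {n : ℕ} {q : Fin n → ℕ} (α : ∀ i, DiffForm I M (q i)) : PathForm M :=
  fun C γ d x v => (-1) ^ (∑ j : Fin n, (q j + 1) * (n - (j + 1))) *
    fiberIntegral d (evPullback α C γ) x v

/-- `λ_r : I^{r-1} → P I^r`. The path `λ_r(s)` is piecewise linear and goes backwards through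
`0 ← s₁e₁ ← s₁e₁ + s₂e₂ ← ⋯ ← s₁e₁ + ⋯ + s_{r-1}e_{r-1} + e_r`, spending time `1 / r` on each of
the `r` segments: it is at the vertex with `k` summands at the time `1 - k / r`. -/
def cubePath (r : ℕ) (s : Fin (r - 1) → ℝ) (t : ℝ) : Fin r → ℝ := fun i =>
  (if h : (i : ℕ) < r - 1 then s ⟨i, h⟩ else 1) * max 0 (min 1 (r * (1 - t) - i))

/-- `π_r : I^r → Δ_r`, `t_i = max {s_i, …, s_r}`. -/
def cubeToSimplex (r : ℕ) (s : Fin r → ℝ) : Fin r → ℝ := fun i =>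
  (Finset.Ici i).sup' Finset.nonempty_Ici s

/-- `θ_r = P π_r ∘ λ_r : I^{r-1} → P Δ_r`. For `r = 0` it maps a point to the constant path at the
point `Δ_0`. -/
def theta (r : ℕ) (s : Fin (r - 1) → ℝ) (t : ℝ) : Fin r → ℝ :=
  cubeToSimplex r (cubePath r s t)

/-- The value `∫_{I^{r-1}} θ_r^* (P σ)^* φ` on an `r`-simplex `σ` of the cochain `S(φ)`. -/
def pathCochain (φ : PathForm M) {r : ℕ} (σ : SmoothSimplex I M r) : ℝ :=
  ∫ s in cube (r - 1), φ (cube (r - 1)) (fun s t => σ.ext (theta r s t)) (r - 1) s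
    (fun i => Pi.single i 1)

/-- Gugenheim's maps `DR_n`, for `n ≥ 1`, on homogeneous forms `α₁, …, αₙ` on `M`: the cochain
`DR_1(α)(σ) = ∫_{Δ_r} σ^* α`, and `DR_n = (-1)^{∑ |α_j| + n} S ∘ C` for `n > 1`. -/
def DR {n : ℕ} {q : Fin n → ℕ} (α : ∀ i, DiffForm I M (q i)) : Cochains I M :=
  Finsupp.linearCombination ℝ fun σ : Σ r : ℕ, SmoothSimplex I M r =>
    if h : n = 1 then integrate (α ⟨0, by omega⟩) σ.2
    else (-1) ^ ((∑ j : Fin n, (q j + 1)) + n) * pathCochain (chen α) σ.2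

end Gugenheim

section EilenbergZilber

/-- `χ` is a `(r₁, …, r_p)`-shuffle: it is increasing on each of the `p` consecutive blocks of
sizes `r₁, …, r_p`. -/
def IsShuffle {p : ℕ} (r : Fin p → ℕ) (χ : Equiv.Perm (Fin (∑ i, r i))) : Prop :=
  ∀ i, StrictMono fun k : Fin (r i) => χ (finSigmaFinEquiv ⟨i, k⟩)

variable {E : Type*} [NormedAddCommGroup E] [NormedSpace ℝ E]
  {H : Type*} [TopologicalSpace H] {I : ModelWithCorners ℝ E H}
  {M : Type*} [TopologicalSpace M] [ChartedSpace H M]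

/-- The decomposable simplex `(σ₁ × ⋯ × σ_p) ∘ χ_*` of `M^p`, where
`χ_*(t) = ((t_{χ(1)}, …, t_{χ(r₁)}), …, (…, t_{χ(r₁ + ⋯ + r_p)}))`. -/
def shuffleSimplex {p : ℕ} {r : Fin p → ℕ} (σ : ∀ i, SmoothSimplex I M (r i))
    (χ : Equiv.Perm (Fin (∑ i, r i))) (hχ : IsShuffle r χ) :
    SmoothSimplex (powModel I p) (Fin p → M) (∑ i, r i) where
  toFun t i := (σ i).toFun ⟨fun k => t.1 (χ (finSigmaFinEquiv ⟨i, k⟩)),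
    fun _ _ h => t.2.1 ((hχ i).monotone h), fun _ => t.2.2 _⟩
  smooth := by
    choose U f hU hs hf hft using fun i => (σ i).smooth
    let L : ∀ i, (Fin (∑ i, r i) → ℝ) → Fin (r i) → ℝ :=
      fun i t k => t (χ (finSigmaFinEquiv ⟨i, k⟩))
    have hL : ∀ i, ContDiff ℝ ∞ (L i) := fun i => contDiff_pi.2 fun k => contDiff_apply ℝ ℝ _
    refine ⟨⋂ i, L i ⁻¹' U i, fun t i => f i (L i t),
      isOpen_iInter_of_finite fun i => (hU i).preimage (hL i).continuous, ?_, ?_, ?_⟩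
    · exact fun t ht => mem_iInter.2 fun i =>
        hs i ⟨fun _ _ h => ht.1 ((hχ i).monotone h), fun _ => ht.2 _⟩
    · exact contMDiffOn_pow I fun i =>
        (hf i).comp (hL i).contMDiff.contMDiffOn fun t ht => mem_iInter.1 ht i
    · exact fun t => funext fun i => hft i ⟨L i t.1, _⟩

open Classical in
/-- The Eilenberg-Zilber map `EZ_p : C_•(M)^{⊗ p} → C_•(M^p)`,
`σ₁ ⊗ ⋯ ⊗ σ_p ↦ ∑_χ (-1)^χ (σ₁ × ⋯ × σ_p) ∘ χ_*`, the sum being over all shuffles. -/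
def EZ (I : ModelWithCorners ℝ E H) (M : Type*) [TopologicalSpace M] [ChartedSpace H M] (p : ℕ) :
    (⨂[ℝ] _ : Fin p, Chains I M) →ₗ[ℝ] Chains (powModel I p) (Fin p → M) :=
  (Finsupp.linearCombination ℝ fun σ : Fin p → Σ r : ℕ, SmoothSimplex I M r =>
    ∑ χ : {χ : Equiv.Perm (Fin (∑ i, (σ i).1)) // IsShuffle (fun i => (σ i).1) χ},
      Finsupp.single (⟨∑ i, (σ i).1, shuffleSimplex (fun i => (σ i).2) χ.1 χ.2⟩ :
        Σ r : ℕ, SmoothSimplex (powModel I p) (Fin p → M) r)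
        ((Equiv.Perm.sign χ.1 : ℤ) : ℝ)) ∘ₗ
    (PiTensorProduct.ofFinsuppEquiv' (R := ℝ) (ι := Fin p)
      (κ := fun _ => Σ r : ℕ, SmoothSimplex I M r)).toLinearMap

end EilenbergZilber

section SimplicialStructure

variable {G : Type*}

/-- The face operators `ε_i : BG_{n+1} → BG_n` of the simplicial manifold `BG_p = G^p`:
`ε_i(g₁, …, g_{n+1}) = (g₁, …, g_i g_{i+1}, …, g_{n+1})` for `0 < i < n + 1`, and `ε_0`, `ε_{n+1}`
drop the first, respectively the last, entry. -/
def face [Group G] {n : ℕ} (i : Fin (n + 2)) (g : Fin (n + 1) → G) : Fin n → G := fun k =>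
  if (k : ℕ) + 1 < i then g k.castSucc
  else if (k : ℕ) + 1 = i then g k.castSucc * g k.succ
  else g k.succ

/-- The map `BG_n → BG_p`, `(g₁, …, gₙ) ↦ (g_{r+1}, …, g_{r+p})`, which the simplicial manifold
`BG_•` assigns to `l_{p,r}^n : [p] → [n]`, `k ↦ k + r`. -/
def block {p r n : ℕ} (h : p + r ≤ n) (g : Fin n → G) : Fin p → G :=
  fun k => g ⟨r + k, by omega⟩

/-- The maps `block` are composites of face operators: `l_{n,0}^n` is the identity, and each
further `l_{p,r}^n` arises by composing with a coface that lies above or below its image. -/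
theorem block_self {n : ℕ} (g : Fin n → G) : block (p := n) (r := 0) le_rfl g = g := by
  funext k
  simp [block]

theorem block_face_of_lt [Group G] {p r n : ℕ} (h : p + r ≤ n) (i : Fin (n + 2))
    (hi : p + r < i) (g : Fin (n + 1) → G) :
    block h (face i g) = block (h.trans n.le_succ) g := by
  funext k
  have : r + (k : ℕ) + 1 < i := by omega
  simp only [block, face, this, if_true]
  rfl

theorem block_face_of_le [Group G] {p r n : ℕ} (h : p + r ≤ n) (i : Fin (n + 2))
    (hi : (i : ℕ) ≤ r) (g : Fin (n + 1) → G) :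
    block h (face i g) = block (p := p) (r := r + 1) (by omega) g := by
  funext k
  have h1 : ¬ r + (k : ℕ) + 1 < i := by omega
  have h2 : ¬ r + (k : ℕ) + 1 = i := by omega
  simp only [block, face, h1, h2, if_false]
  congr 1
  ext
  simp only [Fin.val_succ]
  omega

theorem block_le {n : ℕ} (p : Fin n → ℕ) (i : Fin n) :
    p i + ∑ j ∈ Finset.Iio i, p j ≤ ∑ j, p j := by
  have h := Finset.sum_le_sum_of_subset (f := p) (Finset.subset_univ (insert i (Finset.Iio i)))
  rwa [Finset.sum_insert (by simp)] at h

end SimplicialStructure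

section ClassifyingSpace

variable {E : Type*} [NormedAddCommGroup E] [NormedSpace ℝ E]
  {H : Type*} [TopologicalSpace H] {I : ModelWithCorners ℝ E H}
  {G : Type*} [TopologicalSpace G] [ChartedSpace H G]

theorem contMDiff_block {p r n : ℕ} (h : p + r ≤ n) :
    ContMDiff (powModel I n) (powModel I p) ∞ (block h : (Fin n → G) → Fin p → G) := by
  rw [← contMDiffOn_univ]
  exact contMDiffOn_pow I fun k => (contMDiff_proj I _).contMDiffOn

variable [IsManifold I ∞ G]

/-- A form on `G`, seen as a form on `BG_1 = G^1`. -/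
def toBG1 {q : ℕ} (α : DiffForm I G q) : DiffForm (powModel I 1) (Fin 1 → G) q :=
  α.pullback (fun g : Fin 1 → G => g 0) (contMDiff_proj I 0)

/-- `DR^Δ_{P,n} = EZ_P^* ∘ DR_n`, from forms on `BG_P` to `Δ^P(C_•(G)) = Hom(C_•(G)^{⊗ P}, ℝ)`. -/
def DRDelta {P n : ℕ} {q : Fin n → ℕ} (α : ∀ i, DiffForm (powModel I P) (Fin P → G) (q i)) :
    (⨂[ℝ] _ : Fin P, Chains I G) →ₗ[ℝ] ℝ :=
  DR α ∘ₗ EZ I G P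

/-- The underlying space `⨁_P Hom(C_•(G)^{⊗ P}, ℝ)` both of `Tot(Δ^•(C_•(G)))` and of the
Hochschild cochain complex `HC^•(C_•(G)) = ⨁_P Hom((u C_•(G))^{⊗ P}, ℝ)`; these differ only in the
gradings, as `u C_•(G)` and `C_•(G)` have the same underlying space. -/
abbrev HC (I : ModelWithCorners ℝ E H) (G : Type*) [TopologicalSpace G] [ChartedSpace H G] :
    Type _ :=
  ⨁ P : ℕ, ((⨂[ℝ] _ : Fin P, Chains I G) →ₗ[ℝ] ℝ)

/-- The component `Tot(DR^Δ_•)_n` on homogeneous elements `α_i ∈ Ω^{q_i}(BG_{p_i})`. With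
`P = ∑ p_j` and `r_i = ∑_{j < i} p_j` it is
`(-1)^{∑_{i < j} p_j (q_i + 1)} DR^Δ_{P,n}(u l_{p₁,r₁}^P(α₁) ⊗ ⋯ ⊗ u l_{pₙ,rₙ}^P(αₙ))`. -/
def totDRDelta {n : ℕ} {p q : Fin n → ℕ}
    (α : ∀ i, DiffForm (powModel I (p i)) (Fin (p i) → G) (q i)) : HC I G :=
  DirectSum.lof ℝ ℕ (fun P => (⨂[ℝ] _ : Fin P, Chains I G) →ₗ[ℝ] ℝ) (∑ j, p j)
    ((-1 : ℝ) ^ (∑ i : Fin n, ∑ j ∈ Finset.Ioi i, p j * (q i + 1)) •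
      DRDelta fun i => (α i).pullback (block (block_le p i)) (contMDiff_block _))

open Classical in
/-- The isomorphism `Θ : Tot(Δ^•(C_•(G))) → HC^•(C_•(G))`,
`Θ(s^P φ)(u a₁ ⊗ ⋯ ⊗ u a_P) =
  (-1)^{P |φ| + P (P - 1) / 2 + ∑_{i=1}^{P-1} |a_i| (P - i)} φ(a₁ ⊗ ⋯ ⊗ a_P)`,
given by its values on singular simplices `a_i`. A homogeneous `φ` is nonzero on such a tensor only
if `|φ| = ∑ |a_i|`, so that `|φ|` can be replaced by `∑ |a_i|`. -/
def Theta (I : ModelWithCorners ℝ E H) (G : Type*) [TopologicalSpace G] [ChartedSpace H G] :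
    HC I G →ₗ[ℝ] HC I G :=
  DirectSum.lmap fun P =>
    { toFun := fun φ => (Finsupp.linearCombination ℝ fun a : Fin P → Σ r, SmoothSimplex I G r =>
        (-1 : ℝ) ^ (P * (∑ i, (a i).1) + P * (P - 1) / 2 +
            ∑ i : Fin P, (a i).1 * (P - (i + 1))) *
          φ (PiTensorProduct.tprod ℝ fun i => Finsupp.single (a i) (1 : ℝ))) ∘ₗ
        (PiTensorProduct.ofFinsuppEquiv' (R := ℝ) (ι := Fin P)
          (κ := fun _ => Σ r : ℕ, SmoothSimplex I G r)).toLinearMap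
      map_add' := fun φ ψ => by
        rw [← LinearMap.add_comp]
        congr 1
        ext a
        simp [mul_add]
      map_smul' := fun c φ => by
        rw [RingHom.id_apply, ← LinearMap.smul_comp]
        congr 1
        ext a
        simp [mul_left_comm] }

/-- The component `DR^Θ_n = Θ ∘ Tot(DR^Δ_•)_n` of the `A_∞`-morphism
`DR^Θ : Tot(Ω^•(BG_•)) → HC^•(C_•(G))`, on `u α₁ ⊗ ⋯ ⊗ u αₙ` with homogeneous
`α_i ∈ Ω^{q_i}(BG_{p_i})`. -/
def DRTheta {n : ℕ} {p q : Fin n → ℕ}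
    (α : ∀ i, DiffForm (powModel I (p i)) (Fin (p i) → G) (q i)) : HC I G :=
  Theta I G (totDRDelta α)

end ClassifyingSpace

end HochschildDeRham

end

/-!
The proof is a dimension count. Take singular simplices `σ_1, …, σ_P` of `G` of dimensions
`r_1, …, r_P`. Since every `α_i` lives on `BG_1 = G`, one has `P = n`, and the form fed into `DR_n`
at position `i` is the pullback of `α_i` along a projection `G^P → G`, different positions having
different projections. Along the decomposable simplex `(σ_1 × ⋯ × σ_P) ∘ χ_*`, the pullback to
`Δ_n × I^{R - 1}`, `R = ∑ r_j`, of the form to be integrated is therefore the wedge product of the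
pullbacks of the `α_i` along maps that factor as `Δ_n × I^{R - 1} → Δ_{r_i} → G`. It only sees the
image of the tangent space in `∏ i, ℝ^{r_i}`, of dimension `R`, while fibre integration followed by
integration over the cube evaluates it on `n + (R - 1) > R` tangent vectors. Their images are
linearly dependent, so the integrand vanishes (`wedge_eq_zero_of_finrank_lt`,
`evPullback_pullback_eq_zero`).

The maps `Δ_n × I^{R - 1} → Δ_{r_i}` come from `θ_R`, which is only piecewise smooth. They are
Lipschitz, so by Rademacher's theorem the factorisation holds on tangent spaces at almost every
point, which suffices under the integral sign (`ae_mem_interior_and_differentiable_theta`,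
`pathCochain_chen_shuffleSimplex_eq_zero`).
-/

namespace HochschildDeRham

/-! ### Wedge products and linear dependence -/

section Wedge

variable {n : ℕ} {q : Fin n → ℕ} {F : Fin n → Type*} [∀ i, AddCommGroup (F i)]
  [∀ i, Module ℝ (F i)]

theorem prod_block_update [DecidableEq (Fin (∑ i, q i))]
    (β : ∀ i, MultilinearMap ℝ (fun _ : Fin (q i) => F i) ℝ)
    (x : Fin (∑ i, q i) → ∀ i, F i) (i : Fin n) (j : Fin (q i)) (c : ∀ i, F i) :
    ∏ i', β i' (fun l => Function.update x (finSigmaFinEquiv ⟨i, j⟩) c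
        (finSigmaFinEquiv ⟨i', l⟩) i') =
      β i (Function.update (fun l => x (finSigmaFinEquiv ⟨i, l⟩) i) j (c i)) *
        ∏ i' ∈ Finset.univ.erase i, β i' fun l => x (finSigmaFinEquiv ⟨i', l⟩) i' := by
  rw [← Finset.mul_prod_erase _ _ (Finset.mem_univ i)]
  congr 1
  · congr 1
    funext l
    by_cases h : l = j
    · subst h; simp
    · simp [h]
  · refine Finset.prod_congr rfl fun i' h => ?_
    simp [Finset.ne_of_mem_erase h]

/-- The multilinear form `(β₁ ⊗ ⋯ ⊗ βₙ)(x) = ∏ i, βᵢ(xᵢ)` on `⨁ i, F i`, where `xᵢ` consists of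
the components in `F i` of the vectors of the `i`-th block. -/
def blockProduct (β : ∀ i, MultilinearMap ℝ (fun _ : Fin (q i) => F i) ℝ) :
    MultilinearMap ℝ (fun _ : Fin (∑ i, q i) => ∀ i, F i) ℝ where
  toFun x := ∏ i, β i fun j => x (finSigmaFinEquiv ⟨i, j⟩) i
  map_update_add' x k a b := by
    obtain ⟨⟨i, j⟩, rfl⟩ := finSigmaFinEquiv.surjective k
    simp only [prod_block_update, Pi.add_apply, MultilinearMap.map_update_add, add_mul]
  map_update_smul' x k a b := by
    obtain ⟨⟨i, j⟩, rfl⟩ := finSigmaFinEquiv.surjective k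
    simp only [prod_block_update, Pi.smul_apply, MultilinearMap.map_update_smul, smul_eq_mul,
      mul_assoc]

/-- If each `αᵢ` is, on the vectors `v`, the pullback of a multilinear form on `F i`, then
`α₁ ∧ ⋯ ∧ αₙ` is evaluated through the images of the `v k` in `⨁ i, F i`; it vanishes when these
outnumber the dimension, since the antisymmetrisation of `blockProduct` is alternating. -/
theorem wedge_eq_zero_of_finrank_lt [∀ i, FiniteDimensional ℝ (F i)]
    {V : Type*} [NormedAddCommGroup V] [NormedSpace ℝ V]
    (α : ∀ i, V [⋀^Fin (q i)]→L[ℝ] ℝ) (v : Fin (∑ i, q i) → V)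
    (β : ∀ i, MultilinearMap ℝ (fun _ : Fin (q i) => F i) ℝ) (x : Fin (∑ i, q i) → ∀ i, F i)
    (h : ∀ i (k : Fin (q i) → Fin (∑ i, q i)), α i (fun j => v (k j)) = β i fun j => x (k j) i)
    (hdim : ∑ i, Module.finrank ℝ (F i) < ∑ i, q i) : wedge α v = 0 := by
  have h0 : MultilinearMap.alternatization (blockProduct β) x = 0 := by
    refine AlternatingMap.map_linearDependent _ _ fun hx => ?_
    have := hx.fintype_card_le_finrank
    rw [Module.finrank_pi_fintype, Fintype.card_fin] at this
    omega
  rw [MultilinearMap.alternatization_apply] at h0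
  have h1 : ∑ τ : Equiv.Perm (Fin (∑ i, q i)), ((Equiv.Perm.sign τ : ℤ) : ℝ) *
      ∏ i, α i (fun j => v (τ (finSigmaFinEquiv ⟨i, j⟩))) = 0 := by
    rw [← h0]
    refine Finset.sum_congr rfl fun τ _ => ?_
    rw [Units.smul_def, zsmul_eq_mul]
    congr 1
    exact Finset.prod_congr rfl fun i _ => h i fun j => τ (finSigmaFinEquiv ⟨i, j⟩)
  rw [wedge, h1, mul_zero]

end Wedge

/-! ### Pullbacks of forms along factorised evaluation maps -/

section Pullback

variable {E : Type*} [NormedAddCommGroup E] [NormedSpace ℝ E]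
  {H : Type*} [TopologicalSpace H] {I : ModelWithCorners ℝ E H}
  {M : Type*} [TopologicalSpace M] [ChartedSpace H M] [IsManifold I ∞ M]
  {E' : Type*} [NormedAddCommGroup E'] [NormedSpace ℝ E']
  {H' : Type*} [TopologicalSpace H'] {I' : ModelWithCorners ℝ E' H'}
  {N : Type*} [TopologicalSpace N] [ChartedSpace H' N] [IsManifold I' ∞ N]
  {E'' : Type*} [NormedAddCommGroup E''] [NormedSpace ℝ E'']
  {H'' : Type*} [TopologicalSpace H''] {I'' : ModelWithCorners ℝ E'' H''}
  {L : Type*} [TopologicalSpace L] [ChartedSpace H'' L] [IsManifold I'' ∞ L]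

theorem DiffForm.pullback_pullback {q : ℕ} (α : DiffForm I M q) {f : N → M} {g : L → N}
    (hf : ContMDiff I' I ∞ f) (hg : ContMDiff I'' I' ∞ g) :
    (α.pullback f hf).pullback g hg = α.pullback (f ∘ g) (hf.comp hg) := by
  refine ContMDiffSection.ext fun x => ?_
  ext v
  have h := mfderiv_comp x (hf.mdifferentiableAt (by simp) (x := g x))
    (hg.mdifferentiableAt (by simp) (x := x))
  change α (f (g x)) (fun j => mfderiv I' I f (g x) (mfderiv I'' I' g x (v j))) =
    α (f (g x)) (fun j => mfderiv I'' I (f ∘ g) x (v j))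
  rw [h]
  rfl

/-- If the `i`-th evaluation `y ↦ γ y.2 (y.1 i)`, followed by `e i`, factors through a map `u i`
into `ℝ^{ρ i}` that is differentiable at `z`, and `∑ ρ i` is less than the total degree, then
`ev^*(p₁^* e₁^* α₁ ∧ ⋯ ∧ pₙ^* eₙ^* αₙ)` vanishes at `z`. -/
theorem evPullback_pullback_eq_zero {n m : ℕ} {q ρ : Fin n → ℕ} (α : ∀ i, DiffForm I M (q i))
    (e : Fin n → N → M) (he : ∀ i, ContMDiff I' I ∞ (e i))
    (C : Set (Fin m → ℝ)) (γ : (Fin m → ℝ) → ℝ → N) {z : (Fin n → ℝ) × (Fin m → ℝ)}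
    (hz : z ∈ interior (simplex n ×ˢ C))
    (u : ∀ i, (Fin n → ℝ) × (Fin m → ℝ) → Fin (ρ i) → ℝ)
    (hu : ∀ i, DifferentiableWithinAt ℝ (u i) (simplex n ×ˢ C) z)
    (f : ∀ i, (Fin (ρ i) → ℝ) → M)
    (hf : ∀ i, MDifferentiableAt 𝓘(ℝ, Fin (ρ i) → ℝ) I (f i) (u i z))
    (hfu : ∀ i, ∀ y ∈ simplex n ×ˢ C, e i (γ y.2 (y.1 i)) = f i (u i y))
    (hdim : ∑ i, ρ i < ∑ i, q i)
    (v : Fin (∑ i, q i) → (Fin n → ℝ) × (Fin m → ℝ)) :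
    evPullback (fun i => (α i).pullback (e i) (he i)) C γ z v = 0 := by
  set K := simplex n ×ˢ C with hK
  have hzK : z ∈ K := interior_subset hz
  have hs : UniqueMDiffWithinAt 𝓘(ℝ, (Fin n → ℝ) × (Fin m → ℝ)) K z :=
    (uniqueDiffWithinAt_of_mem_nhds (mem_interior_iff_mem_nhds.1 hz)).uniqueMDiffWithinAt
  -- The differential of the evaluation map, as seen by `α i`, factors through that of `u i`.
  have key : ∀ i, ∃ c : (Fin (ρ i) → ℝ) →ₗ[ℝ] E, ∀ w : (Fin n → ℝ) × (Fin m → ℝ),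
      (mfderiv (powModel I' n) I (e i ∘ fun g : Fin n → N => g i) (evMap n γ z)
        (mfderivWithin 𝓘(ℝ, (Fin n → ℝ) × (Fin m → ℝ)) (powModel I' n) (evMap n γ) K z w) : E) =
      c (fderivWithin ℝ (u i) K z w) := by
    intro i
    by_cases hev : MDifferentiableWithinAt 𝓘(ℝ, (Fin n → ℝ) × (Fin m → ℝ)) (powModel I' n)
        (evMap n γ) K z
    · refine ⟨(mfderiv 𝓘(ℝ, Fin (ρ i) → ℝ) I (f i) (u i z)).toLinearMap, fun w => ?_⟩
      have hei : MDifferentiableAt (powModel I' n) I (e i ∘ fun g : Fin n → N => g i)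
          (evMap n γ z) :=
        ((he i).comp (contMDiff_proj I' i)).mdifferentiableAt (by simp)
      have h1 := mfderiv_comp_mfderivWithin z hei hev hs
      have h2 := mfderiv_comp_mfderivWithin z (hf i) (hu i).mdifferentiableWithinAt hs
      have h3 := mfderivWithin_congr (I := 𝓘(ℝ, (Fin n → ℝ) × (Fin m → ℝ))) (I' := I)
        (f := f i ∘ u i) (f₁ := (e i ∘ fun g : Fin n → N => g i) ∘ evMap n γ)
        (fun y hy => hfu i y hy) (hfu i z hzK)
      have h4 := DFunLike.congr_fun (h1.symm.trans (h3.trans h2)) w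
      rw [mfderivWithin_eq_fderivWithin] at h4
      exact h4
    -- Where `evMap` is not differentiable, `mfderivWithin` takes the value zero.
    · refine ⟨0, fun w => ?_⟩
      rw [mfderivWithin_zero_of_not_mdifferentiableWithinAt hev]
      exact map_zero (mfderiv (powModel I' n) I (e i ∘ fun g : Fin n → N => g i) (evMap n γ z))
  choose c hc using key
  refine wedge_eq_zero_of_finrank_lt (F := fun i => Fin (ρ i) → ℝ) _ _
    (fun i => MultilinearMap.compLinearMap
      (α i (e i (evMap n γ z i)) : E [⋀^Fin (q i)]→L[ℝ] ℝ).toMultilinearMap fun _ => c i)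
    (fun k i => fderivWithin ℝ (u i) K z (v k)) ?_ (by simpa using hdim)
  intro i k
  rw [DiffForm.pullback_pullback]
  refine congrArg (α i (e i (evMap n γ z i)) : E [⋀^Fin (q i)]→L[ℝ] ℝ) (funext fun j => ?_)
  exact hc i (v (k j))

end Pullback

/-! ### Almost everywhere differentiability of Gugenheim's paths -/

section Paths

theorem cubePath_mem_cube {r : ℕ} {s : Fin (r - 1) → ℝ} (hs : s ∈ cube (r - 1)) (t : ℝ) :
    cubePath r s t ∈ cube r := by
  intro i
  have h1 : (if h : (i : ℕ) < r - 1 then s ⟨i, h⟩ else 1) ∈ Icc (0 : ℝ) 1 := by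
    split_ifs with h
    · exact hs _
    · simp
  have h2 : max 0 (min 1 (r * (1 - t) - i)) ∈ Icc (0 : ℝ) 1 := by simp
  exact ⟨mul_nonneg h1.1 h2.1, mul_le_one₀ h1.2 h2.1 h2.2⟩

theorem cubeToSimplex_mem_simplex {r : ℕ} {s : Fin r → ℝ} (hs : s ∈ cube r) :
    cubeToSimplex r s ∈ simplex r := by
  refine ⟨fun i j hij => Finset.sup'_mono _ (Finset.Ici_subset_Ici.2 hij) _, fun i => ⟨?_, ?_⟩⟩
  · exact (hs i).1.trans (Finset.le_sup' s (Finset.mem_Ici.2 le_rfl))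
  · exact Finset.sup'_le _ _ fun j _ => (hs j).2

theorem theta_mem_simplex {r : ℕ} {s : Fin (r - 1) → ℝ} (hs : s ∈ cube (r - 1)) (t : ℝ) :
    theta r s t ∈ simplex r :=
  cubeToSimplex_mem_simplex (cubePath_mem_cube hs t)

theorem lipschitzWith_cubeToSimplex (r : ℕ) : LipschitzWith 1 (cubeToSimplex r) := by
  have h : ∀ (s s' : Fin r → ℝ) i, cubeToSimplex r s i ≤ cubeToSimplex r s' i + dist s s' := by
    intro s s' i
    refine Finset.sup'_le _ _ fun j hj => ?_
    have h1 := Finset.le_sup' s' hj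
    have h2 := (le_abs_self _).trans ((Real.dist_eq _ _).symm.trans_le (dist_le_pi_dist s s' j))
    simp only [cubeToSimplex]
    linarith
  refine LipschitzWith.of_dist_le_mul fun s s' => ?_
  rw [NNReal.coe_one, one_mul, dist_pi_le_iff dist_nonneg]
  intro i
  rw [Real.dist_eq, abs_sub_le_iff]
  have h1 := h s s' i
  have h2 := h s' s i
  rw [dist_comm] at h2
  constructor <;> linarith

theorem lipschitzOnWith_cubePath (r : ℕ) :
    LipschitzOnWith (r + 1) (fun y : (Fin (r - 1) → ℝ) × ℝ => cubePath r y.1 y.2)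
      (cube (r - 1) ×ˢ univ) := by
  refine LipschitzOnWith.of_dist_le_mul fun y hy y' hy' => ?_
  rw [dist_pi_le_iff (by positivity)]
  intro i
  have hclamp : ∀ a b : ℝ, |max 0 (min 1 a) - max 0 (min 1 b)| ≤ |a - b| := fun a b =>
    (abs_max_sub_max_le_max _ _ _ _).trans (max_le (by simp)
      ((abs_min_sub_min_le_max _ _ _ _).trans (by simp)))
  have hb := hclamp (r * (1 - y.2) - i) (r * (1 - y'.2) - i)
  have hy2 : |y.2 - y'.2| ≤ dist y y' := (Real.dist_eq _ _).symm.trans_le (le_max_right _ _)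
  have hb' : |(r * (1 - y.2) - i) - (r * (1 - y'.2) - i)| ≤ r * dist y y' := by
    rw [show (r * (1 - y.2) - i) - (r * (1 - y'.2) - i) = -(r * (y.2 - y'.2) : ℝ) by ring,
      abs_neg, abs_mul, Nat.abs_cast]
    gcongr
  have ha : |(if h : (i : ℕ) < r - 1 then y.1 ⟨i, h⟩ else 1) -
      (if h : (i : ℕ) < r - 1 then y'.1 ⟨i, h⟩ else 1)| ≤ dist y y' := by
    split_ifs with h
    · exact (Real.dist_eq _ _).symm.trans_le ((dist_le_pi_dist y.1 y'.1 _).trans (le_max_left _ _))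
    · simp
  have ha1 : |(if h : (i : ℕ) < r - 1 then y'.1 ⟨i, h⟩ else 1)| ≤ 1 := by
    split_ifs with h
    · exact abs_le.2 ⟨by linarith [(hy'.1 ⟨i, h⟩).1], (hy'.1 ⟨i, h⟩).2⟩
    · simp
  have hb1 : |max 0 (min 1 (r * (1 - y.2) - i))| ≤ (1 : ℝ) := abs_le.2 ⟨by
    linarith [le_max_left 0 (min 1 (r * (1 - y.2) - i))], by simp⟩
  rw [Real.dist_eq]
  simp only [cubePath]
  generalize (if h : (i : ℕ) < r - 1 then y.1 ⟨i, h⟩ else 1) = a at *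
  generalize (if h : (i : ℕ) < r - 1 then y'.1 ⟨i, h⟩ else 1) = a' at *
  generalize max 0 (min 1 (r * (1 - y.2) - i)) = b at *
  generalize max 0 (min 1 (r * (1 - y'.2) - i)) = b' at *
  calc |a * b - a' * b'| = |(a - a') * b + a' * (b - b')| := by ring_nf
    _ ≤ |a - a'| * |b| + |a'| * |b - b'| := by
      rw [← abs_mul, ← abs_mul]; exact abs_add_le _ _
    _ ≤ dist y y' * 1 + 1 * (r * dist y y') := by gcongr; exact hb.trans hb'
    _ = ((r + 1 : NNReal) : ℝ) * dist y y' := by push_cast; ring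

theorem convex_simplex (n : ℕ) : Convex ℝ (simplex n) := by
  intro x hx y hy a b ha hb hab
  refine ⟨fun i j hij => ?_, fun i => convex_Icc (0 : ℝ) 1 (hx.2 i) (hy.2 i) ha hb hab⟩
  have h1 := mul_le_mul_of_nonneg_left (hx.1 hij) ha
  have h2 := mul_le_mul_of_nonneg_left (hy.1 hij) hb
  simpa using add_le_add h1 h2

theorem convex_cube (m : ℕ) : Convex ℝ (cube m) := fun _ hx _ hy _ _ ha hb hab i =>
  convex_Icc (0 : ℝ) 1 (hx i) (hy i) ha hb hab

/-- Almost everywhere differentiability is all one can ask for, as `θ_r` has corners. The boundary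
of a convex set is a null set, and the map `(t, s) ↦ θ_r(s)(t i)` is Lipschitz, so Rademacher's
theorem applies. -/
theorem ae_mem_interior_and_differentiable_theta (n r : ℕ) :
    ∀ᵐ z : (Fin n → ℝ) × (Fin (r - 1) → ℝ), z ∈ simplex n ×ˢ cube (r - 1) →
      z ∈ interior (simplex n ×ˢ cube (r - 1)) ∧ ∀ i, DifferentiableWithinAt ℝ
        (fun y : (Fin n → ℝ) × (Fin (r - 1) → ℝ) => theta r y.2 (y.1 i))
        (simplex n ×ˢ cube (r - 1)) z := by
  have : (volume : Measure ((Fin n → ℝ) × (Fin (r - 1) → ℝ))).IsAddHaarMeasure :=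
    Measure.prod.instIsAddHaarMeasure _ _
  have h1 : ∀ᵐ z : (Fin n → ℝ) × (Fin (r - 1) → ℝ),
      z ∉ frontier (simplex n ×ˢ cube (r - 1)) :=
    measure_eq_zero_iff_ae_notMem.1
      (((convex_simplex n).prod (convex_cube _)).addHaar_frontier volume)
  have h2 : ∀ i, ∀ᵐ z : (Fin n → ℝ) × (Fin (r - 1) → ℝ), z ∈ simplex n ×ˢ cube (r - 1) →
      DifferentiableWithinAt ℝ
        (fun y : (Fin n → ℝ) × (Fin (r - 1) → ℝ) => theta r y.2 (y.1 i))
        (simplex n ×ˢ cube (r - 1)) z := by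
    intro i
    have hsub : LipschitzWith 1 fun y : (Fin n → ℝ) × (Fin (r - 1) → ℝ) => (y.2, y.1 i) := by
      have := LipschitzWith.prod_snd (α := Fin n → ℝ) (β := Fin (r - 1) → ℝ) |>.prodMk
        ((LipschitzWith.eval (α := fun _ : Fin n => ℝ) i).comp LipschitzWith.prod_fst)
      simpa using this
    have := (lipschitzWith_cubeToSimplex r).comp_lipschitzOnWith
      ((lipschitzOnWith_cubePath r).comp (hsub.lipschitzOnWith (s := simplex n ×ˢ cube (r - 1)))
        fun y hy => ⟨hy.2, mem_univ _⟩)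
    exact this.ae_differentiableWithinAt_of_mem
  filter_upwards [h1, ae_all_iff.2 h2] with z hz1 hz2 hz
  exact ⟨by_contra fun h => hz1 ⟨subset_closure hz, h⟩, fun i => hz2 i hz⟩

end Paths

/-! ### Vanishing of iterated integrals on decomposable simplices -/

section Chen

variable {E : Type*} [NormedAddCommGroup E] [NormedSpace ℝ E]
  {H : Type*} [TopologicalSpace H] {I : ModelWithCorners ℝ E H}
  {M : Type*} [TopologicalSpace M] [ChartedSpace H M] [IsManifold I ∞ M]

/-- Chen's iterated integral of at least two forms pulled back from distinct factors of `M^p`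
integrates to zero over every decomposable simplex of `M^p`. -/
theorem pathCochain_chen_shuffleSimplex_eq_zero {n p : ℕ} (hn : 1 < n) {q : Fin n → ℕ}
    (α : ∀ i, DiffForm I M (q i)) {c : Fin n → Fin p} (hc : Function.Injective c)
    {r : Fin p → ℕ} (σ : ∀ i, SmoothSimplex I M (r i))
    (χ : Equiv.Perm (Fin (∑ i, r i))) (hχ : IsShuffle r χ) :
    pathCochain (chen fun i => (α i).pullback (fun g : Fin p → M => g (c i))
      (contMDiff_proj I (c i))) (shuffleSimplex σ χ hχ) = 0 := by
  choose U f hU hs hf hft using fun i => (σ i).smooth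
  -- The map `Δ_n × I^{R - 1} → Δ_{r (c i)}`, `R = ∑ r j`, through which the evaluation at position
  -- `i` followed by the projection to the factor `c i` passes.
  let u : ∀ i : Fin n, (Fin n → ℝ) × (Fin (∑ i, r i - 1) → ℝ) → Fin (r (c i)) → ℝ := fun i y k =>
    theta (∑ i, r i) y.2 (y.1 i) (χ (finSigmaFinEquiv ⟨c i, k⟩))
  have hmem : ∀ i, ∀ y ∈ simplex n ×ˢ cube (∑ i, r i - 1), u i y ∈ simplex (r (c i)) :=
    fun i y hy => ⟨fun _ _ h => (theta_mem_simplex hy.2 _).1 ((hχ (c i)).monotone h),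
      fun _ => (theta_mem_simplex hy.2 _).2 _⟩
  have hdim : ∑ i, r (c i) ≤ ∑ i, r i := by
    rw [← Finset.sum_image (f := r) (s := Finset.univ) (g := c) fun _ _ _ _ h => hc h]
    exact Finset.sum_le_sum_of_subset (Finset.subset_univ _)
  -- Fubini in the form needed for the iterated integral: outer variable in the cube.
  have hae := Measure.ae_ae_of_ae_prod (Measure.measurePreserving_swap.quasiMeasurePreserving.ae
    (ae_mem_interior_and_differentiable_theta n (∑ i, r i)))
  refine setIntegral_eq_zero_of_ae_eq_zero ?_
  filter_upwards [hae] with s hs' hsC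
  simp only [chen, fiberIntegral]
  split_ifs with hN
  · refine mul_eq_zero_of_right _ (setIntegral_eq_zero_of_ae_eq_zero ?_)
    filter_upwards [hs'] with t ht htS
    obtain ⟨hint, hdiff⟩ := ht ⟨htS, hsC⟩
    refine evPullback_pullback_eq_zero α _ _ _ _ hint u (fun i => ?_) (fun i => f (c i))
      (fun i => ?_) (fun i y hy => ?_)
      -- The total degree is `n + (R - 1)`, which exceeds `R` as `1 < n`, even if `R = 0`.
      (by omega) _
    · exact differentiableWithinAt_pi.2 fun k => differentiableWithinAt_pi.1 (hdiff i) _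
    · exact ((hf (c i)).contMDiffAt ((hU (c i)).mem_nhds
        (hs _ (hmem i _ ⟨htS, hsC⟩)))).mdifferentiableAt (by simp)
    · have hext : (shuffleSimplex σ χ hχ).ext (theta (∑ i, r i) y.2 (y.1 i)) =
          (shuffleSimplex σ χ hχ).toFun ⟨_, theta_mem_simplex hy.2 _⟩ :=
        dif_pos (theta_mem_simplex hy.2 _)
      rw [hext]
      exact (hft (c i) ⟨u i y, hmem i y hy⟩).symm
  · simp

end Chen

/-! ### Vanishing on the image of the Eilenberg-Zilber map -/

section ClassifyingSpace

variable {E : Type*} [NormedAddCommGroup E] [NormedSpace ℝ E]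
  {H : Type*} [TopologicalSpace H] {I : ModelWithCorners ℝ E H}
  {G : Type*} [TopologicalSpace G] [ChartedSpace H G] [IsManifold I ∞ G]

theorem DRDelta_pullback_proj_eq_zero {n P : ℕ} (hn : 1 < n) {q : Fin n → ℕ}
    (α : ∀ i, DiffForm I G (q i)) {c : Fin n → Fin P} (hc : Function.Injective c) :
    DRDelta (fun i => (α i).pullback (fun g : Fin P → G => g (c i)) (contMDiff_proj I (c i))) =
      0 := by
  rw [DRDelta, EZ, ← LinearMap.comp_assoc]
  refine (congrArg (fun ψ => ψ ∘ₗ _) ?_).trans (LinearMap.zero_comp _)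
  refine Finsupp.lhom_ext' fun σ => LinearMap.ext_ring ?_
  simp only [LinearMap.comp_apply, Finsupp.lsingle_apply, Finsupp.linearCombination_single,
    one_smul, map_sum, LinearMap.zero_apply]
  refine Finset.sum_eq_zero fun χ _ => ?_
  rw [DR, Finsupp.linearCombination_single, dif_neg (by omega),
    pathCochain_chen_shuffleSimplex_eq_zero hn α hc, mul_zero, smul_zero]

end ClassifyingSpace

end HochschildDeRham

theorem proposition3p18 {E : Type*} [NormedAddCommGroup E] [NormedSpace ℝ E]
    [FiniteDimensional ℝ E] {H : Type*} [TopologicalSpace H] (I : ModelWithCorners ℝ E H)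
    [I.Boundaryless] (G : Type*) [TopologicalSpace G] [ChartedSpace H G] [Group G]
    [LieGroup I ∞ G] (n : ℕ) (hn : 1 < n) (q : Fin n → ℕ)
    (α : ∀ i, HochschildDeRham.DiffForm I G (q i)) :
    HochschildDeRham.DRTheta (I := I) (G := G) (fun i => HochschildDeRham.toBG1 (α i)) = 0 := by
  open HochschildDeRham in
  -- `c i = r_i` is the factor of `G^P` that `l_i` projects to.
  let c : Fin n → Fin (∑ _ : Fin n, 1) := fun i =>
    ⟨∑ _j ∈ Finset.Iio i, 1, by have := block_le (fun _ : Fin n => 1) i; omega⟩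
  have hc : Function.Injective c := fun i j h => by
    have := congrArg Fin.val h
    simpa [c, Fin.ext_iff] using this
  have h := DRDelta_pullback_proj_eq_zero hn α hc
  rw [DRTheta, totDRDelta]
  have h' : (DRDelta fun i => (toBG1 (α i)).pullback (block (block_le (fun _ => 1) i))
      (contMDiff_block _)) = 0 := by
    simp only [toBG1, DiffForm.pullback_pullback]
    exact h
  rw [h', smul_zero, map_zero, map_zero]
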